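/- For a complex $n\times n$ matrix $T$ let $\|T\|$ be its operator norm on the Euclidean space $\mathbb C^n$, let $W(T)=\{\langle Tx,x\rangle : x\in\mathbb C^n,\ \|x\|=1\}$ be its numerical range and $w(T)=\sup\{|\mu| : \mu\in W(T)\}$ its numerical radius. Matrices $A,B$ are unitarily similar if $B=U^*AU$ for some unitary $U$; $T$ is unitarily irreducible if it is not unitarily similar to a direct sum $A\oplus B$ of two square matrices of positive sizes. Let $S(\pi/2)=\{z\in\mathbb C:\operatorname{Re} z\ge 0\}$; thus $W(T)\subseteq S(\pi/2)$ means that $T+T^*$ is positive semidefinite. **Theorem 3.6.** Let $T$ be a nonzero complex $3\times 3$ matrix. Then the following conditions are equivalent: (a) $W(T)\subseteq S(\pi/2)$ and $\|T\|/w(T)=\sqrt2$; (b) $T/\|T\|$ is unitarily similar to a matrix of the form $$\begin{pmatrix} \frac23 & \frac1{\sqrt3} & d\\ -\frac1{\sqrt3} & 0 & \sqrt3\,d\\ d & -\sqrt3\,d & b_1+ib_2\end{pmatrix}$$ with real numbers $d,b_1,b_2$ satisfying $$d\ge 0,\qquad b_1\ge \tfrac{3d^2}{2},\qquad 18d^2+\sqrt{2(12d^2+b_1)^2+2b_2^2}\le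 1 .$$ Moreover, if condition (b) holds with $d>0$, then $T$ is unitarily irreducible. -/

import Mathlib

open scoped Matrix.Norms.L2Operator

noncomputable section

/-- The numerical range `W(T) = {⟨Tx, x⟩ : ‖x‖ = 1}` of a complex matrix acting on the Euclidean
(Hilbert) space `ℂⁿ`. Mathlib's inner product is linear in the second slot, so the number written
`⟨Tx, x⟩` with linearity in the first slot is `inner ℂ x (T x)`. -/
def numericalRange {n : Type*} [Fintype n] [DecidableEq n] (T : Matrix n n ℂ) : Set ℂ :=
  {z | ∃ x : EuclideanSpace ℂ n, ‖x‖ = 1 ∧ z = inner ℂ x (Matrix.toEuclideanCLM (𝕜 := ℂ) T x)}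

/-- The numerical radius `w(T) = sup {|μ| : μ ∈ W(T)}`. -/
def numericalRadius {n : Type*} [Fintype n] [DecidableEq n] (T : Matrix n n ℂ) : ℝ :=
  sSup ((fun z : ℂ => ‖z‖) '' numericalRange T)

/-- The sector `S(α) = {a + ib : |b| ≤ a tan α}`, `0 ≤ α ≤ π/2`. The inequality is multiplied by
`cos α`, so that for `α = π/2` (where `tan α = ∞`) it gives the closed right half-plane. -/
def sector (α : ℝ) : Set ℂ :=
  {z | |z.im| * Real.cos α ≤ z.re * Real.sin α}

theorem sector_eq_of_lt {α : ℝ} (h0 : 0 ≤ α) (h : α < Real.pi / 2) :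
    sector α = {z | |z.im| ≤ z.re * Real.tan α} := by
  ext z
  have hc : 0 < Real.cos α := Real.cos_pos_of_mem_Ioo ⟨by linarith [Real.pi_pos], h⟩
  simp only [sector, Set.mem_ofPred_eq, Real.tan_eq_sin_div_cos, ← mul_div_assoc, le_div_iff₀ hc]

theorem sector_pi_div_two : sector (Real.pi / 2) = {z | 0 ≤ z.re} := by
  ext z
  simp [sector]

/-- `A` and `B` are unitarily similar: `B = U* A U` for some unitary matrix `U`. -/
def UnitarilySimilar {n : Type*} [Fintype n] [DecidableEq n] (A B : Matrix n n ℂ) : Prop :=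
  ∃ U ∈ Matrix.unitaryGroup n ℂ, B = star U * A * U

/-- `T` is unitarily reducible: it is unitarily similar to a direct sum `A ⊕ B` of two square
matrices of positive sizes `p` and `q`. -/
def UnitarilyReducible {n : Type*} [Fintype n] [DecidableEq n] (T : Matrix n n ℂ) : Prop :=
  ∃ (p q : ℕ) (_ : 0 < p) (_ : 0 < q) (e : Fin p ⊕ Fin q ≃ n)
    (A : Matrix (Fin p) (Fin p) ℂ) (B : Matrix (Fin q) (Fin q) ℂ),
    UnitarilySimilar T (Matrix.reindex e e (Matrix.fromBlocks A 0 0 B))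

/-- `T` is unitarily irreducible: it is not unitarily reducible. -/
def UnitarilyIrreducible {n : Type*} [Fintype n] [DecidableEq n] (T : Matrix n n ℂ) : Prop :=
  ¬ UnitarilyReducible T

/-- The explicit `3 × 3` matrix with parameters `d` and `b₁ + i b₂`. -/
def extremalMatrix (d b₁ b₂ : ℝ) : Matrix (Fin 3) (Fin 3) ℂ :=
  !![2 / 3, 1 / ((√3 : ℝ) : ℂ), (d : ℂ);
     -1 / ((√3 : ℝ) : ℂ), 0, ((√3 : ℝ) : ℂ) * (d : ℂ);
     (d : ℂ), -((√3 : ℝ) : ℂ) * (d : ℂ), (b₁ : ℂ) + (b₂ : ℂ) * Complex.I]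

/-- The inequalities imposed on the parameters `d`, `b₁`, `b₂`. -/
def AdmissibleParameters (d b₁ b₂ : ℝ) : Prop :=
  0 ≤ d ∧ 3 * d ^ 2 / 2 ≤ b₁ ∧ 18 * d ^ 2 + √(2 * (12 * d ^ 2 + b₁) ^ 2 + 2 * b₂ ^ 2) ≤ 1

end

/-! ### Unitary invariance and homogeneity of the numerical range -/

section NumericalRange

variable {n : Type*} [Fintype n] [DecidableEq n]

/-! Put `S = T / ‖T‖`, of norm one. Let `S` attain its norm at a unit vector `x` and let `y = S x`,
so that `S* y = x`. On `span {x, y}` the quadratic form of `S` depends only on `⟨x, y⟩` and `⟨x, S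
y⟩`. Accretivity and `w(S) ≤ 1/√2`, tested on `x ± i y` and `x - y`, force these to be `1/2` and `0`
(`inner_eq_of_norm_attained`). Then `x + y` and `x - y`, normalized, start an orthonormal basis. In
it `S x = y`, `S* y = x` and the vanishing of `Re S` at `x - y` determine all entries but `d` and
the last one, which gives the extremal form.

For the extremal matrix the inequalities on the parameters are exact. Completing squares turns
accretivity into `3d²/2 ≤ b₁`. The bound `w ≤ 1/√2` says that `‖x‖² - Re ((P - iQ)⟨Tx, x⟩)` is
nonnegative whenever `P² + Q² = 2`; this is two squares plus a multiple of `|x₂|²`, and the minimum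
of that coefficient over the circle yields the square root. The reverse bound `1/√2 ≤ w` holds for
all parameters. The norm is one by normalization, so the norm of the extremal matrix is never
computed.

A reducible `3 × 3` matrix shares an eigenvector with its adjoint, which the inequalities exclude
when `d > 0`. -/

theorem UnitarilySimilar.symm {A B : Matrix n n ℂ} (h : UnitarilySimilar A B) :
    UnitarilySimilar B A := by
  obtain ⟨U, hU, rfl⟩ := h
  refine ⟨star U, Unitary.star_mem hU, ?_⟩
  have h1 : U * star U = 1 := Matrix.mem_unitaryGroup_iff.1 hU
  calc A = (U * star U) * A * (U * star U) := by rw [h1, one_mul, mul_one]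
    _ = star (star U) * (star U * A * U) * star U := by rw [star_star]; noncomm_ring

theorem UnitarilySimilar.trans {A B C : Matrix n n ℂ} (h : UnitarilySimilar A B)
    (h' : UnitarilySimilar B C) : UnitarilySimilar A C := by
  obtain ⟨U, hU, rfl⟩ := h
  obtain ⟨V, hV, rfl⟩ := h'
  exact ⟨U * V, mul_mem hU hV, by rw [star_mul]; noncomm_ring⟩

theorem UnitarilySimilar.smul {A B : Matrix n n ℂ} (h : UnitarilySimilar A B) (c : ℂ) :
    UnitarilySimilar (c • A) (c • B) := by
  obtain ⟨U, hU, rfl⟩ := h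
  exact ⟨U, hU, by simp⟩

theorem norm_toEuclideanCLM_of_mem_unitaryGroup {U : Matrix n n ℂ}
    (hU : U ∈ Matrix.unitaryGroup n ℂ) (x : EuclideanSpace ℂ n) :
    ‖Matrix.toEuclideanCLM (𝕜 := ℂ) U x‖ = ‖x‖ := by
  have h : star U * U = 1 := Matrix.mem_unitaryGroup_iff'.1 hU
  have h1 : inner ℂ (Matrix.toEuclideanCLM (𝕜 := ℂ) U x) (Matrix.toEuclideanCLM (𝕜 := ℂ) U x)
      = inner ℂ x x := by
    rw [← ContinuousLinearMap.adjoint_inner_right, ← ContinuousLinearMap.star_eq_adjoint,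
      ← map_star, ← mul_apply_eq_comp, ← map_mul, h, map_one,
      one_apply_eq_self]
  rw [inner_self_eq_norm_sq_to_K, inner_self_eq_norm_sq_to_K] at h1
  have h2 : ‖Matrix.toEuclideanCLM (𝕜 := ℂ) U x‖ ^ 2 = ‖x‖ ^ 2 := by exact_mod_cast h1
  exact (sq_eq_sq₀ (norm_nonneg _) (norm_nonneg _)).1 h2

theorem inner_conj_toEuclideanCLM (A U : Matrix n n ℂ) (x y : EuclideanSpace ℂ n) :
    inner ℂ x (Matrix.toEuclideanCLM (𝕜 := ℂ) (star U * A * U) y) =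
      inner ℂ (Matrix.toEuclideanCLM (𝕜 := ℂ) U x)
        (Matrix.toEuclideanCLM (𝕜 := ℂ) A (Matrix.toEuclideanCLM (𝕜 := ℂ) U y)) := by
  rw [map_mul, map_mul, map_star, ContinuousLinearMap.star_eq_adjoint,
    mul_apply_eq_comp, mul_apply_eq_comp,
    ContinuousLinearMap.adjoint_inner_right]

theorem UnitarilySimilar.numericalRange_eq {A B : Matrix n n ℂ} (h : UnitarilySimilar A B) :
    numericalRange B = numericalRange A := by
  have key : ∀ {A B : Matrix n n ℂ}, UnitarilySimilar A B →
      numericalRange B ⊆ numericalRange A := by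
    rintro A _ ⟨U, hU, rfl⟩ z ⟨x, hx, rfl⟩
    exact ⟨Matrix.toEuclideanCLM (𝕜 := ℂ) U x,
      by rw [norm_toEuclideanCLM_of_mem_unitaryGroup hU, hx], inner_conj_toEuclideanCLM A U x x⟩
  exact (key h).antisymm (key h.symm)

theorem UnitarilySimilar.numericalRadius_eq {A B : Matrix n n ℂ} (h : UnitarilySimilar A B) :
    numericalRadius B = numericalRadius A := by
  rw [numericalRadius, numericalRadius, h.numericalRange_eq]

theorem exists_unit_smul {E : Type*} [NormedAddCommGroup E] [NormedSpace ℂ E] {x : E}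
    (hx : x ≠ 0) : ∃ u : E, ‖u‖ = 1 ∧ x = (‖x‖ : ℂ) • u := by
  have h : (‖x‖ : ℂ) ≠ 0 := by exact_mod_cast norm_ne_zero_iff.2 hx
  refine ⟨(‖x‖ : ℂ)⁻¹ • x, ?_, by rw [smul_smul, mul_inv_cancel₀ h, one_smul]⟩
  rw [norm_smul, norm_inv, Complex.norm_real, norm_norm, inv_mul_cancel₀ (norm_ne_zero_iff.2 hx)]

theorem inner_smul_clm_smul {E : Type*} [NormedAddCommGroup E] [InnerProductSpace ℂ E]
    (f : E →L[ℂ] E) (r : ℝ) (u : E) :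
    inner ℂ ((r : ℂ) • u) (f ((r : ℂ) • u)) = ((r ^ 2 : ℝ) : ℂ) * inner ℂ u (f u) := by
  rw [map_smul, inner_smul_left, inner_smul_right, Complex.conj_ofReal, ← mul_assoc]
  push_cast
  ring

theorem norm_inner_clm_le {E : Type*} [NormedAddCommGroup E] [InnerProductSpace ℂ E]
    (f : E →L[ℂ] E) (x : E) : ‖inner ℂ x (f x)‖ ≤ ‖f‖ * ‖x‖ ^ 2 := by
  calc ‖inner ℂ x (f x)‖ ≤ ‖x‖ * ‖f x‖ := norm_inner_le_norm _ _
    _ ≤ ‖x‖ * (‖f‖ * ‖x‖) := by gcongr; exact f.le_opNorm x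
    _ = ‖f‖ * ‖x‖ ^ 2 := by ring

theorem numericalRadius_le_iff (A : Matrix n n ℂ) {r : ℝ} (hr : 0 ≤ r) :
    numericalRadius A ≤ r ↔
      ∀ x, ‖inner ℂ x (Matrix.toEuclideanCLM (𝕜 := ℂ) A x)‖ ≤ r * ‖x‖ ^ 2 := by
  constructor
  · intro h x
    by_cases hx : x = 0
    · simp [hx]
    obtain ⟨u, hu, hxu⟩ := exists_unit_smul hx
    have hbdd : BddAbove ((fun z : ℂ => ‖z‖) '' numericalRange A) := by
      refine ⟨‖Matrix.toEuclideanCLM (𝕜 := ℂ) A‖, ?_⟩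
      rintro _ ⟨_, ⟨v, hv, rfl⟩, rfl⟩
      simpa [hv] using norm_inner_clm_le (Matrix.toEuclideanCLM (𝕜 := ℂ) A) v
    have h1 := (le_csSup hbdd ⟨_, ⟨u, hu, rfl⟩, rfl⟩).trans h
    rw [hxu, inner_smul_clm_smul, norm_mul, ← hxu, Complex.norm_real,
      Real.norm_of_nonneg (by positivity), mul_comm]
    gcongr
  · intro h
    refine Real.sSup_le ?_ hr
    rintro _ ⟨_, ⟨v, hv, rfl⟩, rfl⟩
    simpa [hv] using h v

theorem numericalRange_subset_halfPlane_iff (A : Matrix n n ℂ) :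
    numericalRange A ⊆ sector (Real.pi / 2) ↔
      ∀ x, 0 ≤ (inner ℂ x (Matrix.toEuclideanCLM (𝕜 := ℂ) A x)).re := by
  rw [sector_pi_div_two]
  constructor
  · intro h x
    by_cases hx : x = 0
    · simp [hx]
    obtain ⟨u, hu, hxu⟩ := exists_unit_smul hx
    have h1 : 0 ≤ (inner ℂ u (Matrix.toEuclideanCLM (𝕜 := ℂ) A u)).re := h ⟨u, hu, rfl⟩
    rw [hxu, inner_smul_clm_smul, Complex.re_ofReal_mul]
    positivity
  · rintro h _ ⟨v, -, rfl⟩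
    exact h v

theorem numericalRange_smul (A : Matrix n n ℂ) (c : ℂ) :
    numericalRange (c • A) = (fun z => c * z) '' numericalRange A := by
  ext z
  constructor
  · rintro ⟨x, hx, rfl⟩
    exact ⟨_, ⟨x, hx, rfl⟩, by simp⟩
  · rintro ⟨_, ⟨x, hx, rfl⟩, rfl⟩
    exact ⟨x, hx, by simp⟩

theorem numericalRadius_smul (A : Matrix n n ℂ) {r : ℝ} (hr : 0 ≤ r) :
    numericalRadius ((r : ℂ) • A) = r * numericalRadius A := by
  rw [numericalRadius, numericalRadius, numericalRange_smul, ← smul_eq_mul,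
    ← Real.sSup_smul_of_nonneg hr, Set.image_image, ← Set.image_smul, Set.image_image]
  simp [abs_of_nonneg hr]

theorem numericalRange_smul_subset_halfPlane_iff (A : Matrix n n ℂ) {r : ℝ} (hr : 0 < r) :
    numericalRange ((r : ℂ) • A) ⊆ sector (Real.pi / 2) ↔
      numericalRange A ⊆ sector (Real.pi / 2) := by
  rw [numericalRange_smul, sector_pi_div_two, Set.image_subset_iff]
  refine forall₂_congr fun z _ => ?_
  simp [hr]

end NumericalRange

/-! ### Numerical radius and accretivity of the extremal matrix -/

theorem inner_extremalMatrix (d b₁ b₂ : ℝ) (x : EuclideanSpace ℂ (Fin 3)) :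
    inner ℂ x (Matrix.toEuclideanCLM (𝕜 := ℂ) (extremalMatrix d b₁ b₂) x) = 
      star (x 0) * (2 / 3 * x 0 + 1 / (√3 : ℝ) * x 1 + d * x 2) +
      star (x 1) * (-1 / (√3 : ℝ) * x 0 + (√3 : ℝ) * d * x 2) +
      star (x 2) * (d * x 0 - (√3 : ℝ) * d * x 1 + (b₁ + b₂ * Complex.I) * x 2) := by
  simp only [EuclideanSpace.inner_eq_star_dotProduct, Matrix.ofLp_toEuclideanCLM, extremalMatrix, dotProduct, Matrix.mulVec,
    Fin.sum_univ_three]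
  simp
  ring

/-- Completion of squares for `‖x‖² - Re ((P - iQ) ⟨Tx, x⟩)`, where `T` is the extremal matrix. -/
theorem norm_sq_sub_re_inner_extremalMatrix {P Q : ℝ} (hPQ : P ^ 2 + Q ^ 2 = 2) (d b₁ b₂ : ℝ)
    (x : EuclideanSpace ℂ (Fin 3)) :
    ‖x‖ ^ 2 - ((P - Q * Complex.I) * inner ℂ x
        (Matrix.toEuclideanCLM (𝕜 := ℂ) (extremalMatrix d b₁ b₂) x)).re =
      ‖x 1 - Complex.I * Q / (√3 : ℝ) * x 0 + Complex.I * (√3 : ℝ) * Q * d * x 2‖ ^ 2 +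
        1 / 3 * ‖(1 - P : ℂ) * x 0 + 3 * d * (2 + P) * x 2‖ ^ 2 +
        (1 - 18 * d ^ 2 - P * (12 * d ^ 2 + b₁) - Q * b₂) * ‖x 2‖ ^ 2 := by
  rw [inner_extremalMatrix, EuclideanSpace.norm_sq_eq, Fin.sum_univ_three]
  obtain ⟨s, hs, h1, h2⟩ : ∃ s : ℝ, s ^ 2 = 3 ∧ √3 = s ∧ ((s : ℂ)⁻¹ = (s / 3 : ℝ)) := by
    have h : √3 ^ 2 = (3 : ℝ) := Real.sq_sqrt (by norm_num)
    refine ⟨√3, h, rfl, ?_⟩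
    rw [← Complex.ofReal_inv]
    congr 1
    field_simp
    linarith
  simp only [div_eq_mul_inv, h1, h2, Complex.sq_norm, Complex.normSq_apply]
  have hQ : Q ^ 2 = 2 - P ^ 2 := by linarith
  simp [-neg_mul]
  ring_nf
  simp only [hs, hQ]
  ring

/-- Cauchy–Schwarz: the root is the maximum of `P A + Q B` on the circle of radius `√2`. -/
theorem add_sqrt_le_one_iff (k A B : ℝ) :
    k + √(2 * A ^ 2 + 2 * B ^ 2) ≤ 1 ↔
      ∀ P Q : ℝ, P ^ 2 + Q ^ 2 = 2 → 0 ≤ 1 - k - P * A - Q * B := by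
  constructor
  · intro h P Q hPQ
    have h1 : P * A + Q * B ≤ √(2 * A ^ 2 + 2 * B ^ 2) := by
      refine Real.le_sqrt_of_sq_le ?_
      have h2 : (P * A + Q * B) ^ 2 + (P * B - Q * A) ^ 2 = (P ^ 2 + Q ^ 2) * (A ^ 2 + B ^ 2) := by
        ring
      rw [hPQ] at h2
      linarith [sq_nonneg (P * B - Q * A)]
    linarith
  · intro h
    have hS := Real.sq_sqrt (by positivity : 0 ≤ 2 * A ^ 2 + 2 * B ^ 2)
    set S := √(2 * A ^ 2 + 2 * B ^ 2)
    by_cases hS0 : S = 0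
    -- There is no maximizing direction when `S = 0`; averaging two antipodal points gives `k ≤ 1`.
    · have h1 := h 1 1 (by norm_num)
      have h2 := h (-1) (-1) (by norm_num)
      rw [hS0]
      linarith
    · have h1 := h (2 * A / S) (2 * B / S) (by field_simp; linarith)
      have h2 : 2 * A / S * A + 2 * B / S * B = S := by field_simp; linarith
      linarith

/-- A closed linear inequality on the circle of radius `√2` may be checked off the line `P = 1`. -/
theorem nonneg_on_circle_of_ne {k A B : ℝ}
    (h : ∀ P Q : ℝ, P ^ 2 + Q ^ 2 = 2 → P ≠ 1 → 0 ≤ 1 - k - P * A - Q * B) {P Q : ℝ}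
    (hPQ : P ^ 2 + Q ^ 2 = 2) : 0 ≤ 1 - k - P * A - Q * B := by
  by_cases hP : P = 1
  swap
  · exact h P Q hPQ hP
  have hQ : Q ≠ 0 := by
    rintro rfl
    rw [hP] at hPQ
    norm_num at hPQ
  -- Rotate `(P, Q)` by `t`: the first coordinate has derivative `-Q ≠ 0` at `0`, so it leaves the
  -- value `1` at once; then let `t → 0`.
  have hd : HasDerivAt (fun t : ℝ => P * Real.cos t - Q * Real.sin t)
      (P * -Real.sin 0 - Q * Real.cos 0) 0 :=
    ((Real.hasDerivAt_cos 0).const_mul P).sub ((Real.hasDerivAt_sin 0).const_mul Q)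
  have hne := hd.eventually_ne (c := 1) (by simpa using hQ)
  have hlim : Filter.Tendsto (fun t : ℝ => 1 - k - (P * Real.cos t - Q * Real.sin t) * A -
      (P * Real.sin t + Q * Real.cos t) * B) (nhdsWithin 0 {0}ᶜ)
      (nhds (1 - k - P * A - Q * B)) := by
    refine Filter.Tendsto.mono_left ?_ nhdsWithin_le_nhds
    refine Continuous.tendsto' (by fun_prop) _ _ (by simp)
  refine ge_of_tendsto hlim ?_
  filter_upwards [hne] with t ht
  refine h _ _ ?_ ht
  calc _ = (P ^ 2 + Q ^ 2) * (Real.sin t ^ 2 + Real.cos t ^ 2) := by ring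
    _ = 2 := by rw [Real.sin_sq_add_cos_sq, hPQ, mul_one]

theorem norm_le_inv_sqrt_two_mul_iff (z : ℂ) (r : ℝ) :
    ‖z‖ ≤ 1 / √2 * r ↔
      ∀ P Q : ℝ, P ^ 2 + Q ^ 2 = 2 → 0 ≤ r - ((P - Q * Complex.I) * z).re := by
  have h2 : √2 ^ 2 = (2 : ℝ) := Real.sq_sqrt (by norm_num)
  have hpos : 0 < √2 := by positivity
  rw [one_div, inv_mul_eq_div, le_div_iff₀ hpos]
  have hre : ∀ P Q : ℝ, ((P - Q * Complex.I) * z).re = P * z.re + Q * z.im := by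
    intro P Q
    simp
  simp only [hre]
  have h := add_sqrt_le_one_iff (1 - r) z.re z.im
  have hn : √(2 * z.re ^ 2 + 2 * z.im ^ 2) = ‖z‖ * √2 := by
    rw [← mul_add, Complex.norm_def, Complex.normSq_apply, Real.sqrt_mul (by norm_num), mul_comm]
    congr 2
    ring
  rw [hn] at h
  calc ‖z‖ * √2 ≤ r ↔ 1 - r + ‖z‖ * √2 ≤ 1 := by constructor <;> intro h <;> linarith
    _ ↔ _ := h
    _ ↔ _ := by simp only [sub_sub_cancel, sub_sub]

theorem numericalRadius_extremalMatrix_le_iff (d b₁ b₂ : ℝ) :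
    numericalRadius (extremalMatrix d b₁ b₂) ≤ 1 / √2 ↔
      18 * d ^ 2 + √(2 * (12 * d ^ 2 + b₁) ^ 2 + 2 * b₂ ^ 2) ≤ 1 := by
  rw [numericalRadius_le_iff _ (by positivity), add_sqrt_le_one_iff]
  simp only [norm_le_inv_sqrt_two_mul_iff]
  constructor
  · intro h P Q hPQ
    refine nonneg_on_circle_of_ne (fun P Q hPQ hP => ?_) hPQ
    -- This vector annihilates both squares; its last entry `1 - P` must be nonzero to expose the
    -- remaining coefficient.
    have h1 := h !₂[-(3 * d * (2 + P) : ℂ),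
      -(Complex.I * Q / (√3 : ℝ) * (3 * d * (2 + P)) + Complex.I * (√3 : ℝ) * Q * d * (1 - P)),
      1 - P] P Q hPQ
    rw [norm_sq_sub_re_inner_extremalMatrix hPQ] at h1
    have e : -((1 - P) * (3 * d * (2 + P))) + 3 * d * (2 + P) * (1 - P) = (0 : ℂ) := by ring
    have hpos : 0 < ‖(1 - P : ℂ)‖ ^ 2 := by
      have : (1 - P : ℂ) ≠ 0 := by
        rw [sub_ne_zero]
        exact_mod_cast Ne.symm hP
      positivity
    simp [e] at h1
    exact nonneg_of_mul_nonneg_left h1 hpos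
  · intro h x P Q hPQ
    rw [norm_sq_sub_re_inner_extremalMatrix hPQ]
    have := h P Q hPQ
    positivity

theorem le_numericalRadius_extremalMatrix (d b₁ b₂ : ℝ) :
    1 / √2 ≤ numericalRadius (extremalMatrix d b₁ b₂) := by
  have h0 : 0 ≤ numericalRadius (extremalMatrix d b₁ b₂) :=
    Real.sSup_nonneg (by rintro _ ⟨z, -, rfl⟩; exact norm_nonneg z)
  -- For `P = Q = 1` all three terms of the completed square vanish at this vector.
  have h := (numericalRadius_le_iff _ h0).1 le_rfl !₂[1, Complex.I / (√3 : ℝ), 0]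
  set x : EuclideanSpace ℂ (Fin 3) := !₂[1, Complex.I / (√3 : ℝ), 0]
  have hx : 0 < ‖x‖ := norm_pos_iff.2 fun hx0 => by simpa [x] using congrArg (fun v => v 0) hx0
  set z := inner ℂ x (Matrix.toEuclideanCLM (𝕜 := ℂ) (extremalMatrix d b₁ b₂) x)
  have hid : ‖x‖ ^ 2 - (((1 : ℝ) - (1 : ℝ) * Complex.I) * z).re = 0 := by
    rw [norm_sq_sub_re_inner_extremalMatrix (by norm_num)]
    simp [x]
  have hz : ‖x‖ ^ 2 ≤ ‖z‖ * √2 := by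
    have h1 : ‖((1 : ℝ) - (1 : ℝ) * Complex.I : ℂ)‖ = √2 := by
      rw [Complex.norm_def, Complex.normSq_apply]
      norm_num
    have h2 := Complex.re_le_norm (((1 : ℝ) - (1 : ℝ) * Complex.I) * z)
    rw [norm_mul, h1] at h2
    linarith
  rw [div_le_iff₀ (by positivity)]
  have h3 : 1 * ‖x‖ ^ 2 ≤ numericalRadius (extremalMatrix d b₁ b₂) * √2 * ‖x‖ ^ 2 := by
    have := mul_le_mul_of_nonneg_right h (Real.sqrt_nonneg 2)
    linarith
  exact le_of_mul_le_mul_right h3 (by positivity)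

theorem numericalRange_extremalMatrix_subset_halfPlane_iff (d b₁ b₂ : ℝ) :
    numericalRange (extremalMatrix d b₁ b₂) ⊆ sector (Real.pi / 2) ↔ 3 * d ^ 2 / 2 ≤ b₁ := by
  have key : ∀ x : EuclideanSpace ℂ (Fin 3), (inner ℂ x
      (Matrix.toEuclideanCLM (𝕜 := ℂ) (extremalMatrix d b₁ b₂) x)).re =
      2 / 3 * ‖x 0 + 3 * d / 2 * x 2‖ ^ 2 + (b₁ - 3 * d ^ 2 / 2) * ‖x 2‖ ^ 2 := by
    intro x
    rw [inner_extremalMatrix]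
    simp only [← Complex.ofReal_inv, div_eq_mul_inv, Complex.sq_norm, Complex.normSq_apply]
    simp [-neg_mul]
    ring
  rw [numericalRange_subset_halfPlane_iff]
  simp only [key]
  constructor
  · intro h
    have h1 := h !₂[-(3 * d / 2), 0, 1]
    simp at h1
    exact h1
  · intro h x
    have := sub_nonneg.2 h
    positivity

/-! ### Norm-attaining vectors and the equality case -/

section NormAttaining

variable {E : Type*} [NormedAddCommGroup E] [InnerProductSpace ℂ E]

theorem exists_norm_apply_eq_norm [FiniteDimensional ℂ E] [Nontrivial E] (f : E →L[ℂ] E) :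
    ∃ x, ‖x‖ = 1 ∧ ‖f x‖ = ‖f‖ := by
  have : ProperSpace E := FiniteDimensional.proper ℂ E
  have : NormedSpace ℝ E := NormedSpace.restrictScalars ℝ ℂ E
  obtain ⟨x₀, hx₀⟩ := exists_ne (0 : E)
  obtain ⟨u, hu, -⟩ := exists_unit_smul hx₀
  obtain ⟨x, hx, hmax⟩ := (isCompact_sphere (0 : E) 1).exists_isMaxOn ⟨u, by simpa using hu⟩
    (f := fun x => ‖f x‖) (by fun_prop)
  have hx1 : ‖x‖ = 1 := by simpa using hx
  refine ⟨x, hx1, le_antisymm (by simpa [hx1] using f.le_opNorm x) ?_⟩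
  refine f.opNorm_le_bound (norm_nonneg _) fun v => ?_
  by_cases hv : v = 0
  · simp [hv]
  obtain ⟨w, hw, hvw⟩ := exists_unit_smul hv
  have h1 : ‖f w‖ ≤ ‖f x‖ := hmax (by simpa using hw)
  have h2 : ‖f v‖ = ‖v‖ * ‖f w‖ := by
    conv_lhs => rw [hvw]
    rw [map_smul, norm_smul, Complex.norm_real, norm_norm]
  rw [h2, mul_comm]
  gcongr

/-- Equality in Cauchy–Schwarz: `⟨f* f x, x⟩ = 1` with both vectors of norm at most one. -/
theorem adjoint_apply_eq_of_norm_eq_one [CompleteSpace E] {f : E →L[ℂ] E} (hf : ‖f‖ = 1) {x : E}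
    (hx : ‖x‖ = 1) (hfx : ‖f x‖ = 1) : ContinuousLinearMap.adjoint f (f x) = x := by
  have h1 : ‖ContinuousLinearMap.adjoint f (f x)‖ ≤ 1 := by
    simpa [hf, hfx] using (ContinuousLinearMap.adjoint f).le_opNorm (f x)
  have h2 : inner ℂ (ContinuousLinearMap.adjoint f (f x)) x = 1 := by
    rw [ContinuousLinearMap.adjoint_inner_left, inner_self_eq_norm_sq_to_K, hfx]
    norm_num
  have h3 := @norm_sub_sq ℂ _ _ _ _ (ContinuousLinearMap.adjoint f (f x)) x
  rw [h2, hx] at h3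
  simp at h3
  have h4 : ‖ContinuousLinearMap.adjoint f (f x)‖ ^ 2 ≤ 1 := pow_le_one₀ (norm_nonneg _) h1
  have h5 : ‖ContinuousLinearMap.adjoint f (f x) - x‖ ^ 2 = 0 :=
    le_antisymm (by linarith) (by positivity)
  exact sub_eq_zero.1 (norm_eq_zero.1 (pow_eq_zero_iff two_ne_zero |>.1 h5))

/-- If a quadratic form with nonnegative real part has vanishing real part at `u`, then `u` lies in
the kernel of its real part. -/
theorem inner_add_conj_inner_eq_zero {f : E →L[ℂ] E} (hf : ∀ v, 0 ≤ (inner ℂ v (f v)).re) {u : E}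
    (hu : (inner ℂ u (f u)).re = 0) (v : E) :
    inner ℂ u (f v) + star (inner ℂ v (f u)) = 0 := by
  set a := inner ℂ u (f v) + star (inner ℂ v (f u)) with ha
  set k := (inner ℂ v (f v)).re with hk
  have hk0 : 0 ≤ k := hf v
  have key : ∀ ε : ℝ, 0 ≤ -ε * ‖a‖ ^ 2 + ε ^ 2 * ‖a‖ ^ 2 * k := by
    intro ε
    have h := hf (u + (-(ε : ℂ) * star a) • v)
    simp only [map_add, map_smul, inner_add_left, inner_add_right, inner_smul_left,
      inner_smul_right, Complex.add_re, hu] at h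
    have e1 : a.re = (inner ℂ u (f v)).re + (inner ℂ v (f u)).re := by
      rw [ha, Complex.add_re, Complex.star_def, Complex.conj_re]
    have e2 : a.im = (inner ℂ u (f v)).im - (inner ℂ v (f u)).im := by
      rw [ha, Complex.add_im, Complex.star_def, Complex.conj_im, sub_eq_add_neg]
    refine h.trans_eq ?_
    rw [hk, Complex.sq_norm, Complex.normSq_apply]
    simp
    linear_combination (-ε * a.re) * e1.symm + (-ε * a.im) * e2.symm
  -- For small `ε` the linear term wins; `k + 1` also covers `k = 0`.
  have h := key (1 / (k + 1))
  have h1 : -(1 / (k + 1)) * ‖a‖ ^ 2 + (1 / (k + 1)) ^ 2 * ‖a‖ ^ 2 * k =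
      -(‖a‖ ^ 2 / (k + 1) ^ 2) := by
    field_simp
    ring
  rw [h1] at h
  by_contra hne
  have : 0 < ‖a‖ ^ 2 / (k + 1) ^ 2 := by positivity
  linarith

/-- The equality case of `‖f‖ ≤ √2 w(f)` for accretive `f`. -/
theorem inner_eq_of_norm_attained [CompleteSpace E] {f : E →L[ℂ] E} {x y : E} (hx : ‖x‖ = 1)
    (hy : ‖y‖ = 1) (hfx : f x = y) (hfy : ContinuousLinearMap.adjoint f y = x)
    (hacc : ∀ v, 0 ≤ (inner ℂ v (f v)).re)
    (hw : ∀ v, ‖inner ℂ v (f v)‖ ≤ 1 / √2 * ‖v‖ ^ 2) :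
    inner ℂ x y = 1 / 2 ∧ inner ℂ x (f y) = 0 := by
  have hyy : inner ℂ y y = 1 := by rw [inner_self_eq_norm_sq_to_K, hy]; norm_num
  have hyfy : inner ℂ y (f y) = inner ℂ x y := by
    rw [← ContinuousLinearMap.adjoint_inner_left, hfy]
  set c := inner ℂ x y
  set s := inner ℂ x (f y)
  have hw2 : ∀ v, 2 * ‖inner ℂ v (f v)‖ ^ 2 ≤ (‖v‖ ^ 2) ^ 2 := by
    intro v
    have h := pow_le_pow_left₀ (norm_nonneg _) (hw v) 2
    rw [mul_pow, div_pow, Real.sq_sqrt (by norm_num)] at h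
    linarith
  have hq : ∀ β : ℂ, inner ℂ (x + β • y) (f (x + β • y)) =
      c + β * s + star β + star β * β * c := by
    intro β
    simp only [map_add, map_smul, inner_add_left, inner_add_right, inner_smul_left,
      inner_smul_right, hfx, hyy, hyfy]
    simp only [starRingEnd_apply, c, s]
    ring
  have hn : ∀ β : ℂ, ‖x + β • y‖ ^ 2 = 1 + 2 * (β * c).re + ‖β‖ ^ 2 := by
    intro β
    rw [@norm_add_sq ℂ, inner_smul_right, norm_smul, hx, hy]
    simp [c]
  -- Adding the bounds at `±i` cancels the cross terms and leaves `16|c|² + 4|s - 1|² ≤ 8 + 8 (Im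
  -- c)²`. Accretivity at `x - y` gives `1 - Re s ≥ 2 - 2 Re c`, which may be squared because `Re c
  -- ≤ 1`. Together they bound a sum of squares by zero.
  have a1 := hw2 (x + Complex.I • y)
  have a2 := hw2 (x + (-Complex.I) • y)
  have a3 := hacc (x + (-1 : ℂ) • y)
  have a4 : c.re ≤ 1 := by
    have h := (Complex.re_le_norm c).trans (norm_inner_le_norm x y)
    rwa [hx, hy, one_mul] at h
  rw [hq, hn, Complex.sq_norm, Complex.normSq_apply] at a1 a2
  rw [hq] at a3
  simp at a1 a2 a3
  ring_nf at a1 a2 a3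
  have a5 : (2 - 2 * c.re) ^ 2 ≤ (1 - s.re) ^ 2 :=
    pow_le_pow_left₀ (by linarith) (by linarith) 2
  have a6 : 8 * (2 * c.re - 1) ^ 2 + 8 * c.im ^ 2 + 4 * s.im ^ 2 ≤ 0 := by linarith
  have hc1 : 2 * c.re - 1 = 0 := pow_eq_zero_iff two_ne_zero |>.1
    (le_antisymm (by nlinarith) (sq_nonneg _))
  have hc2 : c.im = 0 := pow_eq_zero_iff two_ne_zero |>.1
    (le_antisymm (by nlinarith) (sq_nonneg _))
  have hs2 : s.im = 0 := pow_eq_zero_iff two_ne_zero |>.1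
    (le_antisymm (by nlinarith) (sq_nonneg _))
  have hc1' : c.re = 1 / 2 := by linarith
  rw [hc1', hc2, hs2] at a1
  rw [hc1'] at a3
  have hs1 : s.re = 0 := by nlinarith
  exact ⟨Complex.ext (by simp [hc1']) (by simp [hc2]), Complex.ext hs1 hs2⟩

end NormAttaining

/-! ### Reduction to the extremal form -/

theorem unitarilySimilar_of_orthonormalBasis {n : Type*} [Fintype n] [DecidableEq n]
    (A : Matrix n n ℂ) (b : OrthonormalBasis n ℂ (EuclideanSpace ℂ n)) :
    UnitarilySimilar A
      (Matrix.of fun i j => inner ℂ (b i) (Matrix.toEuclideanCLM (𝕜 := ℂ) A (b j))) := by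
  set U : Matrix n n ℂ := Matrix.of fun i j => b j i with hU
  refine ⟨U, Matrix.mem_unitaryGroup_iff'.2 ?_, ?_⟩
  · ext i j
    have h := orthonormal_iff_ite.1 b.orthonormal i j
    rw [EuclideanSpace.inner_eq_star_dotProduct] at h
    rw [Matrix.one_apply, ← h, Matrix.mul_apply]
    simp [hU, dotProduct, mul_comm]
  · ext i j
    rw [Matrix.of_apply, EuclideanSpace.inner_eq_star_dotProduct, Matrix.ofLp_toEuclideanCLM,
      mul_assoc, Matrix.mul_apply, dotProduct]
    refine Finset.sum_congr rfl fun k _ => ?_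
    rw [mul_comm]
    simp [hU, Matrix.mul_apply, Matrix.mulVec, dotProduct]

theorem exists_orthonormalBasis_fin_three {u v : EuclideanSpace ℂ (Fin 3)} (hu : ‖u‖ = 1)
    (hv : ‖v‖ = 1) (huv : inner ℂ u v = 0) :
    ∃ b : OrthonormalBasis (Fin 3) ℂ (EuclideanSpace ℂ (Fin 3)), b 0 = u ∧ b 1 = v := by
  have hvu : inner ℂ v u = 0 := by rw [← inner_conj_symm, huv, map_zero]
  obtain ⟨b, hb⟩ := Orthonormal.exists_orthonormalBasis_extension_of_card_eq (𝕜 := ℂ)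
    (E := EuclideanSpace ℂ (Fin 3)) (ι := Fin 3) (by simp) (v := ![u, v, 0]) (s := {0, 1}) (by
      rw [orthonormal_iff_ite]
      rintro ⟨i, hi⟩ ⟨j, hj⟩
      simp only [Set.mem_insert_iff, Set.mem_singleton_iff] at hi hj
      rcases hi with rfl | rfl <;> rcases hj with rfl | rfl <;>
        simp [Set.domRestrict, hu, hv, huv, hvu])
  exact ⟨b, hb 0 (by simp), hb 1 (by simp)⟩

theorem exists_norm_eq_one_mul_eq_norm (z : ℂ) : ∃ u : ℂ, ‖u‖ = 1 ∧ z * u = ‖z‖ := by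
  by_cases hz : z = 0
  · exact ⟨1, by simp, by simp [hz]⟩
  have h : (‖z‖ : ℂ) ≠ 0 := by exact_mod_cast norm_ne_zero_iff.2 hz
  refine ⟨star z / ‖z‖, ?_, ?_⟩
  · simp [norm_ne_zero_iff.2 hz]
  · rw [← mul_div_assoc, Complex.star_def, Complex.mul_conj, Complex.normSq_eq_norm_sq]
    push_cast
    field_simp

theorem exists_unitarilySimilar_extremalMatrix {S : Matrix (Fin 3) (Fin 3) ℂ} (hS : ‖S‖ = 1)
    (hacc : numericalRange S ⊆ sector (Real.pi / 2)) (hw : numericalRadius S ≤ 1 / √2) :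
    ∃ d b₁ b₂ : ℝ, 0 ≤ d ∧ UnitarilySimilar S (extremalMatrix d b₁ b₂) := by
  rw [numericalRange_subset_halfPlane_iff] at hacc
  rw [numericalRadius_le_iff _ (by positivity)] at hw
  rw [Matrix.cstar_norm_def] at hS
  have hsim := unitarilySimilar_of_orthonormalBasis S
  set f := Matrix.toEuclideanCLM (𝕜 := ℂ) S
  obtain ⟨x, hx, hfx⟩ := exists_norm_apply_eq_norm f
  rw [hS] at hfx
  have hadj := adjoint_apply_eq_of_norm_eq_one hS hx hfx
  obtain ⟨y, hy⟩ : ∃ y, f x = y := ⟨_, rfl⟩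
  rw [hy] at hfx hadj
  obtain ⟨hc, hs⟩ := inner_eq_of_norm_attained hx hfx hy hadj hacc hw
  have hxx : inner ℂ x x = (1 : ℂ) := by rw [inner_self_eq_norm_sq_to_K, hx]; norm_num
  have hyy : inner ℂ y y = (1 : ℂ) := by rw [inner_self_eq_norm_sq_to_K, hfx]; norm_num
  have hyx : inner ℂ y x = (1 / 2 : ℂ) := by rw [← inner_conj_symm, hc, map_div₀, map_one, map_ofNat]
  have hyfv : ∀ v, inner ℂ y (f v) = inner ℂ x v := fun v => by
    rw [← ContinuousLinearMap.adjoint_inner_left, hadj]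
  obtain ⟨r, hr⟩ : ∃ r : ℝ, √3 = r := ⟨_, rfl⟩
  have hr2 : (r : ℂ) ^ 2 = 3 := by
    have : r ^ 2 = 3 := by rw [← hr, Real.sq_sqrt (by norm_num)]
    exact_mod_cast this
  have hr0 : (r : ℂ) ≠ 0 := by
    rintro h
    simp [h] at hr2
  -- Since `⟨x, y⟩ = 1/2`, `‖x + y‖² = 3`, `‖x - y‖ = 1` and the two are orthogonal.
  set e₁ := ((r : ℂ)⁻¹) • (x + y) with he₁
  set e₂ := x - y with he₂
  clear_value e₁ e₂
  have hone : ∀ v : EuclideanSpace ℂ (Fin 3), inner ℂ v v = (1 : ℂ) → ‖v‖ = 1 := by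
    intro v hv
    rw [@norm_eq_sqrt_re_inner ℂ, hv]
    simp
  have h11 : ‖e₁‖ = 1 := hone _ <| by
    simp only [he₁, inner_smul_left, inner_smul_right, inner_add_left, inner_add_right, hxx, hyy,
      hc, hyx, map_inv₀, Complex.conj_ofReal]
    field_simp
    rw [hr2]
    norm_num
  have h22 : ‖e₂‖ = 1 := hone _ <| by
    simp only [he₂, inner_sub_left, inner_sub_right, hxx, hyy, hc, hyx]
    norm_num
  have h12 : inner ℂ e₁ e₂ = 0 := by
    simp only [he₁, he₂, inner_smul_left, inner_add_left, inner_sub_right, hxx, hyy, hc, hyx]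
    norm_num
  obtain ⟨b, hb0, hb1⟩ := exists_orthonormalBasis_fin_three h11 h22 h12
  -- The free phase of the third basis vector makes the entry `d` real and nonnegative.
  obtain ⟨u, hu, hzu⟩ := exists_norm_eq_one_mul_eq_norm (inner ℂ e₁ (f (b 2)))
  set g := u • b 2 with hg
  have horth : ∀ i, i ≠ 2 → inner ℂ (b i) (b 2) = (0 : ℂ) := fun i hi => b.orthonormal.2 hi
  have h1g : inner ℂ e₁ g = 0 := by rw [hg, inner_smul_right, ← hb0, horth 0 (by decide), mul_zero]
  have h2g : inner ℂ e₂ g = 0 := by rw [hg, inner_smul_right, ← hb1, horth 1 (by decide), mul_zero]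
  have hgn : ‖g‖ = 1 := by rw [hg, norm_smul, hu, b.orthonormal.1, one_mul]
  clear_value g
  have hxe : x = (r / 2 : ℂ) • e₁ + (1 / 2 : ℂ) • e₂ := by
    rw [he₁, he₂, smul_smul, show (r / 2 : ℂ) * (r : ℂ)⁻¹ = 1 / 2 by field_simp]
    module
  have hye : y = (r / 2 : ℂ) • e₁ - (1 / 2 : ℂ) • e₂ := by
    rw [he₁, he₂, smul_smul, show (r / 2 : ℂ) * (r : ℂ)⁻¹ = 1 / 2 by field_simp]
    module
  have hg1 : inner ℂ g e₁ = 0 := by rw [← inner_conj_symm, h1g, map_zero]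
  have hg2 : inner ℂ g e₂ = 0 := by rw [← inner_conj_symm, h2g, map_zero]
  -- the matrix entries of `f` in the basis `e₁, e₂, g`
  have m11 : inner ℂ e₁ (f e₁) = 2 / 3 := by
    simp only [he₁, map_smul, map_add, inner_smul_left, inner_smul_right, inner_add_left,
      inner_add_right, hy, hyfv, hyy, hc, hs, map_inv₀, Complex.conj_ofReal]
    field_simp
    rw [hr2]
    norm_num
  have m12 : inner ℂ e₁ (f e₂) = 1 / (r : ℂ) := by
    simp only [he₁, he₂, map_sub, inner_smul_left, inner_add_left,
      inner_sub_right, hy, hyfv, hyy, hc, hs, map_inv₀, Complex.conj_ofReal]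
    field_simp
    norm_num
  have m21 : inner ℂ e₂ (f e₁) = -1 / (r : ℂ) := by
    simp only [he₁, he₂, map_smul, map_add, inner_smul_right, inner_sub_left,
      inner_add_right, hy, hyfv, hyy, hc, hs]
    field_simp
    norm_num
  have m22 : inner ℂ e₂ (f e₂) = 0 := by
    simp only [he₂, map_sub, inner_sub_left, inner_sub_right, hy, hyfv, hyy, hc, hs]
    norm_num
  have m13 : inner ℂ e₁ (f g) = ((‖inner ℂ e₁ (f (b 2))‖ : ℝ) : ℂ) := by
    rw [hg, map_smul, inner_smul_right, mul_comm, hzu]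
  set d := ‖inner ℂ e₁ (f (b 2))‖
  have m23 : inner ℂ e₂ (f g) = r * d := by
    -- `f* y = x` is orthogonal to `g`.
    have h : inner ℂ y (f g) = 0 := by
      rw [hyfv, hxe, inner_add_left, inner_smul_left, inner_smul_left, h1g, h2g]
      simp
    rw [hye, inner_sub_left, inner_smul_left, inner_smul_left, m13] at h
    simp only [map_div₀, map_one, map_ofNat, Complex.conj_ofReal] at h
    linear_combination (-2) * h
  have m32 : inner ℂ g (f e₂) = -r * d := by
    -- The zero diagonal entry puts `e₂` in the kernel of `Re f`, so this entry is minus the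
    -- conjugate of its transpose.
    have h := inner_add_conj_inner_eq_zero hacc (u := e₂) (by rw [m22]; rfl) g
    rw [m23] at h
    have h' := congrArg star h
    simp at h'
    linear_combination h'
  have m31 : inner ℂ g (f e₁) = d := by
    have h : inner ℂ g (f x) = 0 := by
      rw [hy, hye, inner_sub_right, inner_smul_right, inner_smul_right, hg1, hg2]
      simp
    rw [hxe, map_add, map_smul, map_smul, inner_add_right, inner_smul_right, inner_smul_right,
      m32] at h
    refine mul_left_cancel₀ hr0 ?_
    linear_combination 2 * h
  have hbasis : Orthonormal ℂ ![e₁, e₂, g] := by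
    have h21 : inner ℂ e₂ e₁ = 0 := by rw [← inner_conj_symm, h12, map_zero]
    rw [orthonormal_iff_ite]
    intro i j
    fin_cases i <;> fin_cases j <;> simp [h11, h22, hgn, h12, h21, h1g, h2g, hg1, hg2]
  obtain ⟨b', hb'⟩ : ∃ b' : OrthonormalBasis (Fin 3) ℂ (EuclideanSpace ℂ (Fin 3)),
      ⇑b' = ![e₁, e₂, g] :=
    ⟨OrthonormalBasis.mk hbasis
      (hbasis.linearIndependent.span_eq_top_of_card_eq_finrank (by simp)).ge, by simp⟩
  refine ⟨d, (inner ℂ g (f g)).re, (inner ℂ g (f g)).im, norm_nonneg _, ?_⟩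
  convert hsim b' using 1
  rw [hb', extremalMatrix, hr, Complex.re_add_im]
  ext i j
  fin_cases i <;> fin_cases j <;> simp [m11, m12, m13, m21, m22, m23, m31, m32]

/-! ### Irreducibility -/

/-- As `p + q = 3`, one block has size one; the corresponding column of `U` spans a reducing line.
-/
theorem exists_common_eigenvector_of_unitarilyReducible {T : Matrix (Fin 3) (Fin 3) ℂ}
    (h : UnitarilyReducible T) :
    ∃ (v : Fin 3 → ℂ) (l : ℂ), v ≠ 0 ∧ T.mulVec v = l • v ∧
      Matrix.vecMul (star v) T = l • star v := by
  obtain ⟨p, q, hp, hq, e, A, B, U, hU, hD⟩ := h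
  set D := Matrix.reindex e e (Matrix.fromBlocks A 0 0 B) with hDdef
  have hcard : p + q = 3 := by simpa using Fintype.card_congr e
  obtain ⟨i, hi⟩ : ∃ i, ∀ j, j ≠ i → D i j = 0 ∧ D j i = 0 := by
    have hD' : ∀ a b, D (e a) (e b) = Matrix.fromBlocks A 0 0 B a b := fun a b => by
      simp [hDdef]
    rcases (by omega : p = 1 ∨ q = 1) with rfl | rfl
    · refine ⟨e (Sum.inl 0), fun j hj => ?_⟩
      obtain ⟨a, rfl⟩ := e.surjective j
      rw [hD', hD']
      rcases a with a | a
      · exact absurd (congrArg (fun a => e (Sum.inl a)) (Subsingleton.elim a 0)) hj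
      · simp
    · refine ⟨e (Sum.inr 0), fun j hj => ?_⟩
      obtain ⟨a, rfl⟩ := e.surjective j
      rw [hD', hD']
      rcases a with a | a
      · simp
      · exact absurd (congrArg (fun a => e (Sum.inr a)) (Subsingleton.elim a 0)) hj
  have h1 : U * star U = 1 := Matrix.mem_unitaryGroup_iff.1 hU
  have h2 : star U * U = 1 := Matrix.mem_unitaryGroup_iff'.1 hU
  have hTU : T * U = U * D := by
    rw [hD, ← mul_assoc, ← mul_assoc, h1, one_mul]
  have hUT : star U * T = D * star U := by
    rw [hD, mul_assoc _ U, h1, mul_one]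
  refine ⟨fun k => U k i, D i i, ?_, ?_, ?_⟩
  · intro h0
    have := congrFun (congrFun h2 i) i
    rw [Matrix.mul_apply, Finset.sum_eq_zero fun k _ => by
      rw [show U k i = 0 from congrFun h0 k, mul_zero]] at this
    simp at this
  · ext k
    have h := congrFun (congrFun hTU k) i
    rw [Matrix.mul_apply, Matrix.mul_apply] at h
    have h3 : ∑ j, U k j * D j i = U k i * D i i :=
      Finset.sum_eq_single i (fun j _ hj => by rw [(hi j hj).2, mul_zero]) (by simp)
    rw [h3, mul_comm (U k i)] at h
    exact h
  · ext k
    have h := congrFun (congrFun hUT i) k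
    rw [Matrix.mul_apply, Matrix.mul_apply] at h
    have h3 : ∑ j, D i j * star U j k = D i i * star U i k :=
      Finset.sum_eq_single i (fun j _ hj => by rw [(hi j hj).1, zero_mul]) (by simp)
    rw [h3] at h
    exact h

theorem UnitarilySimilar.unitarilyReducible {n : Type*} [Fintype n] [DecidableEq n]
    {A B : Matrix n n ℂ} (h : UnitarilySimilar A B) (hA : UnitarilyReducible A) :
    UnitarilyReducible B := by
  obtain ⟨p, q, hp, hq, e, X, Y, hXY⟩ := hA
  exact ⟨p, q, hp, hq, e, X, Y, h.symm.trans hXY⟩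

theorem UnitarilyReducible.smul {n : Type*} [Fintype n] [DecidableEq n]
    {A : Matrix n n ℂ} (hA : UnitarilyReducible A) (c : ℂ) : UnitarilyReducible (c • A) := by
  obtain ⟨p, q, hp, hq, e, X, Y, hXY⟩ := hA
  refine ⟨p, q, hp, hq, e, c • X, c • Y, ?_⟩
  convert hXY.smul c using 1
  ext i j
  rcases h1 : e.symm i with a | a <;> rcases h2 : e.symm j with b | b <;> simp [h1, h2]

theorem unitarilyIrreducible_extremalMatrix {d b₁ b₂ : ℝ} (h : AdmissibleParameters d b₁ b₂)
    (hd : 0 < d) : UnitarilyIrreducible (extremalMatrix d b₁ b₂) := by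
  intro hred
  obtain ⟨-, -, hle⟩ := h
  obtain ⟨v, l, hv, hr, hl⟩ := exists_common_eigenvector_of_unitarilyReducible hred
  have hb₁ : 12 * d ^ 2 + b₁ ≤ √(2 * (12 * d ^ 2 + b₁) ^ 2 + 2 * b₂ ^ 2) :=
    Real.le_sqrt_of_sq_le (by nlinarith [sq_nonneg (12 * d ^ 2 + b₁), sq_nonneg b₂])
  have hb₂ : |b₂| ≤ √(2 * (12 * d ^ 2 + b₁) ^ 2 + 2 * b₂ ^ 2) :=
    Real.abs_le_sqrt (by nlinarith [sq_nonneg (12 * d ^ 2 + b₁), sq_nonneg b₂])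
  have hd2 : 0 < d ^ 2 := by positivity
  have hdC : (d : ℂ) ≠ 0 := by exact_mod_cast hd.ne'
  have hl' : ∀ j, star (Matrix.vecMul (star v) (extremalMatrix d b₁ b₂) j) = star l * v j := by
    intro j
    rw [hl]
    simp
  obtain ⟨s, hs, hs'⟩ : ∃ s : ℝ, (s : ℂ) ^ 2 = 3 ∧ √3 = s := by
    refine ⟨√3, ?_, rfl⟩
    exact_mod_cast Real.sq_sqrt (by norm_num : (0 : ℝ) ≤ 3)
  have hs0 : (s : ℂ) ≠ 0 := by
    intro h
    simp [h] at hs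
  have hinv : (s : ℂ)⁻¹ = s / 3 := by
    field_simp
    exact hs.symm
  have r0 := congrFun hr 0
  have r1 := congrFun hr 1
  have r2 := congrFun hr 2
  have l0 := hl' 0
  have l1 := hl' 1
  have l2 := hl' 2
  simp [extremalMatrix, Matrix.mulVec, Matrix.vecMul, dotProduct, Fin.sum_univ_three, hs',
    hinv, div_eq_mul_inv, -neg_mul] at r0 r1 r2 l0 l1 l2
  set m := (starRingEnd ℂ) l
  have hv' : v 0 = 0 → v 1 = 0 → v 2 = 0 → False := fun h0 h1 h2 =>
    hv (funext fun i => by fin_cases i <;> assumption)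
  by_cases h1 : v 1 = 0
  · rw [h1] at r1 l0 r0 r2 l2
    have e0 : v 0 = 3 * d * v 2 := mul_left_cancel₀ hs0 (by linear_combination (-3) * r1)
    have h2 : v 2 ≠ 0 := fun h2 => hv' (by rw [e0, h2, mul_zero]) h1 h2
    have e1 : l + m = 2 := by
      refine mul_left_cancel₀ (mul_ne_zero hdC h2) ?_
      rw [e0] at r0 l0
      linear_combination (-1 / 3) * r0 - 1 / 3 * l0
    -- This contradicts `30 d² + b₁ ≤ 1`, a consequence of admissibility.
    have e2 : (3 * d ^ 2 + b₁ : ℂ) = 1 := by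
      refine mul_left_cancel₀ h2 ?_
      rw [e0] at r2 l2
      linear_combination 1 / 2 * r2 + 1 / 2 * l2 + v 2 / 2 * e1
    have e3 : 3 * d ^ 2 + b₁ = 1 := by exact_mod_cast e2
    linarith
  · have e : l + m = 0 := mul_right_cancel₀ h1 (by linear_combination -r1 - l1)
    have e0 : v 0 = -(3 / 2) * d * v 2 := by
      linear_combination 3 / 4 * r0 + 3 / 4 * l0 + 3 / 4 * v 0 * e
    have e1 : v 1 = -(3 / 4) * s * d * (l - m) * v 2 := by
      linear_combination s / 2 * (r0 - l0) + s / 2 * (l - m) * e0 - v 1 / 3 * hs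
    have h2 : v 2 ≠ 0 := fun h2 => h1 (by rw [e1, h2]; ring)
    have e2 : (1 - 9 / 2 * d ^ 2) * (l - m) = 2 * b₂ * Complex.I := by
      refine mul_left_cancel₀ h2 ?_
      linear_combination l2 - r2 - 2 * s * d * e1 + 3 / 2 * d ^ 2 * (l - m) * v 2 * hs
    -- Hence `l = ±i`, and `e2` gives `|1 - 9d²/2| = |b₂|`, against `|b₂| ≤ 1 - 18 d²`.
    have e3 : (l - m) ^ 2 = -4 := by
      refine mul_left_cancel₀ (mul_ne_zero hdC h2) ?_
      linear_combination 4 / 9 * s * (r1 - l1) + 4 / 9 * s * (l - m) * e1 +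
        8 / 27 * s ^ 2 * e0 - (4 / 3 * d * v 2 + 1 / 3 * d * (l - m) ^ 2 * v 2) * hs
    have e4 : ((1 - 9 / 2 * d ^ 2) ^ 2 : ℂ) = b₂ ^ 2 := by
      linear_combination 1 / 4 * (1 - 9 / 2 * d ^ 2 : ℂ) ^ 2 * e3 - 1 / 4 *
        ((1 - 9 / 2 * d ^ 2) * (l - m) + 2 * b₂ * Complex.I) * e2 - b₂ ^ 2 * Complex.I_sq
    have e5 : (1 - 9 / 2 * d ^ 2) ^ 2 = b₂ ^ 2 := by
      refine Complex.ofReal_injective ?_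
      push_cast
      exact e4
    have e6 : |1 - 9 / 2 * d ^ 2| = |b₂| := (sq_eq_sq_iff_abs_eq_abs _ _).1 e5
    have e7 := le_abs_self (1 - 9 / 2 * d ^ 2)
    linarith

/-! ### The theorem -/

theorem theorem3p6 (T : Matrix (Fin 3) (Fin 3) ℂ) (hT : T ≠ 0) :
    ((numericalRange T ⊆ sector (Real.pi / 2) ∧ ‖T‖ / numericalRadius T = √2) ↔
      ∃ d b₁ b₂ : ℝ, AdmissibleParameters d b₁ b₂ ∧
        UnitarilySimilar ((‖T‖ : ℂ)⁻¹ • T) (extremalMatrix d b₁ b₂)) ∧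
    (∀ d b₁ b₂ : ℝ, AdmissibleParameters d b₁ b₂ → 0 < d →
      UnitarilySimilar ((‖T‖ : ℂ)⁻¹ • T) (extremalMatrix d b₁ b₂) →
      UnitarilyIrreducible T) := by
  have hpos : 0 < ‖T‖ := norm_pos_iff.2 hT
  have hinv : (‖T‖ : ℂ)⁻¹ = ((‖T‖⁻¹ : ℝ) : ℂ) := by push_cast; rfl
  have hsqrt : 0 < √2 := by positivity
  refine ⟨?_, fun d b₁ b₂ hadm hd hsim hred =>
    unitarilyIrreducible_extremalMatrix hadm hd (hsim.unitarilyReducible (hred.smul _))⟩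
  have hnorm : ‖(‖T‖ : ℂ)⁻¹ • T‖ = 1 := by
    rw [norm_smul, norm_inv, Complex.norm_real, norm_norm, inv_mul_cancel₀ hpos.ne']
  have hrange : numericalRange ((‖T‖ : ℂ)⁻¹ • T) ⊆ sector (Real.pi / 2) ↔
      numericalRange T ⊆ sector (Real.pi / 2) := by
    rw [hinv, numericalRange_smul_subset_halfPlane_iff _ (inv_pos.2 hpos)]
  have hradius : numericalRadius ((‖T‖ : ℂ)⁻¹ • T) = 1 / √2 ↔
      ‖T‖ / numericalRadius T = √2 := by
    rw [hinv, numericalRadius_smul _ (inv_nonneg.2 hpos.le), ← inv_inj, mul_inv, inv_inv,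
      one_div, inv_inv, div_eq_mul_inv]
  rw [← hrange, ← hradius]
  constructor
  · rintro ⟨hacc, hw⟩
    obtain ⟨d, b₁, b₂, hd, hsim⟩ := exists_unitarilySimilar_extremalMatrix hnorm hacc hw.le
    rw [← hsim.numericalRange_eq, numericalRange_extremalMatrix_subset_halfPlane_iff] at hacc
    rw [← hsim.numericalRadius_eq] at hw
    exact ⟨d, b₁, b₂, ⟨hd, hacc, (numericalRadius_extremalMatrix_le_iff d b₁ b₂).1 hw.le⟩, hsim⟩
  · rintro ⟨d, b₁, b₂, ⟨-, hb, hle⟩, hsim⟩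
    rw [← hsim.numericalRange_eq, numericalRange_extremalMatrix_subset_halfPlane_iff,
      ← hsim.numericalRadius_eq]
    exact ⟨hb, le_antisymm ((numericalRadius_extremalMatrix_le_iff d b₁ b₂).2 hle)
      (le_numericalRadius_extremalMatrix d b₁ b₂)⟩
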